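/- Let $G=(V,E)$ be a finite, simple, connected, non-bipartite graph on $n$ vertices with adjacency matrix $A$, and let $\lambda_0>\lambda_1>\cdots>\lambda_d$ be the distinct eigenvalues of $A$, so that $G$ has exactly $d+1$ distinct eigenvalues. On real polynomials put $\langle p,q\rangle_G=\frac1n\operatorname{tr}\bigl(p(A)q(A)\bigr)$ and $\|p\|_G^2=\langle p,p\rangle_G$. Let $p_0,\dots,p_d$ be the predistance polynomials of $G$, i.e. the unique sequence of polynomials with $\deg p_i=i$ that are pairwise orthogonal with respect to $\langle\cdot,\cdot\rangle_G$ and satisfy $\|p_i\|_G^2=p_i(\lambda_0)$. Let $$\alpha_i=\frac{\langle xp_i,p_i\rangle_G}{\|p_i\|_G^2}\quad(0\le i\le d),\qquad \gamma_i=\frac{\langle xp_{i-1},p_i\rangle_G}{\|p_i\|_G^2}\quad(1\le i\le d)$$ be the preintersection numbers, i.e. the coefficients in the three-term recurrence $xp_i=\beta_{i-1}p_{i-1}+\alpha_ip_i+\gamma_{i+1}p_{i+1}$ (read modulo the minimal polynomial of $A$ when $i=d$, with $p_{-1}=p_{d+1}=0$). The odd-girth of a graph is the length of its shortest odd cycle.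 A connected graph is distance-regular if, for all vertices $u,v$, the numbers of neighbours of $v$ at distance $i-1$, $i$ and $i+1$ from $u$, where $i$ is the distance between $u$ and $v$, depend only on $i$; a generalized Odd graph is a distance-regular graph with odd-girth $2D+1$, where $D$ is its diameter. (i) If $\alpha_i\ge 0$ for $i=0,\dots,d-1$, then $$\gamma_d\ \ge\ -(\lambda_1+\cdots+\lambda_d),$$ with equality if and only if $G$ is a generalized Odd graph. (ii) If $G$ has odd-girth at least $2d-1$ and $\gamma_d=-(\lambda_1+\cdots+\lambda_d)$, then $G$ is a generalized Odd graph. -/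

import Mathlib

open Polynomial

noncomputable section

namespace SimpleGraph

section Spectral

variable {V : Type*} [Fintype V] [DecidableEq V] (G : SimpleGraph V) [DecidableRel G.Adj]

/-- The set of distinct eigenvalues of the (real) adjacency matrix of `G`. -/
def distinctEigenvalues : Finset ℝ :=
  (G.adjMatrix ℝ).charpoly.roots.toFinset

/-- The distinct eigenvalues `λ₀ > λ₁ > ⋯ > λ_d` of the adjacency matrix in decreasing order
(with value `0` for indices larger than `d`). -/
def distinctEigenvalue (i : ℕ) : ℝ :=
  (G.distinctEigenvalues.sort (· ≥ ·)).getD i 0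

/-- The scalar product `⟨p, q⟩ = (1 / n) tr (p(A) q(A))` on real polynomials. -/
def spectralInner (p q : ℝ[X]) : ℝ :=
  (aeval (G.adjMatrix ℝ) p * aeval (G.adjMatrix ℝ) q).trace / (Fintype.card V : ℝ)

/-- The monic orthogonal polynomials `q₀, q₁, …` of the scalar product: Gram-Schmidt
orthogonalization of `1, x, x ^ 2, …`. -/
def monicOrthPoly : ℕ → ℝ[X]
  | i => X ^ i - ∑ j : Fin i,
      C (G.spectralInner (X ^ i) (monicOrthPoly j) /
          G.spectralInner (monicOrthPoly j) (monicOrthPoly j)) * monicOrthPoly j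
termination_by i => i
decreasing_by all_goals exact j.2

/-- The predistance polynomials `p₀, …, p_d`: the orthogonal polynomials `p_i` of degree `i`,
scaled such that `⟨p_i, p_i⟩ = p_i(λ₀)`. -/
def predistancePoly (i : ℕ) : ℝ[X] :=
  C ((G.monicOrthPoly i).eval (G.distinctEigenvalue 0) /
      G.spectralInner (G.monicOrthPoly i) (G.monicOrthPoly i)) * G.monicOrthPoly i

/-- The preintersection number `α_i`: the coefficient of `p_i` in the expansion
`x p_i = β_{i-1} p_{i-1} + α_i p_i + γ_{i+1} p_{i+1}` with respect to the orthogonal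
polynomials `p₀, …, p_d`. -/
def preintersectionAlpha (i : ℕ) : ℝ :=
  G.spectralInner (X * G.predistancePoly i) (G.predistancePoly i) /
    G.spectralInner (G.predistancePoly i) (G.predistancePoly i)

/-- The preintersection number `γ_i`: `γ₀ = 0`, and `γ_{i+1}` is the coefficient of `p_{i+1}` in
the expansion `x p_i = β_{i-1} p_{i-1} + α_i p_i + γ_{i+1} p_{i+1}`. -/
def preintersectionGamma : ℕ → ℝ
  | 0 => 0
  | i + 1 =>
    G.spectralInner (X * G.predistancePoly i) (G.predistancePoly (i + 1)) /
      G.spectralInner (G.predistancePoly (i + 1)) (G.predistancePoly (i + 1))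

end Spectral

section Combinatorial

variable {V : Type*} (G : SimpleGraph V)

/-- The odd-girth of `G`: the length of a shortest odd cycle (`⊤` if there is none). -/
def oddGirth : ℕ∞ :=
  ⨅ (v : V) (w : G.Walk v v) (_ : w.IsCycle ∧ Odd w.length), (w.length : ℕ∞)

/-- `c_i(u, v) = |S_{i-1}(u) ∩ S_1(v)|` for vertices `u, v` at distance `i`. -/
def interC (u v : V) : ℕ := {w : V | G.Adj v w ∧ G.dist u w + 1 = G.dist u v}.ncard

/-- `a_i(u, v) = |S_i(u) ∩ S_1(v)|` for vertices `u, v` at distance `i`. -/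
def interA (u v : V) : ℕ := {w : V | G.Adj v w ∧ G.dist u w = G.dist u v}.ncard

/-- `b_i(u, v) = |S_{i+1}(u) ∩ S_1(v)|` for vertices `u, v` at distance `i`. -/
def interB (u v : V) : ℕ := {w : V | G.Adj v w ∧ G.dist u w = G.dist u v + 1}.ncard

/-- A (finite) connected graph is distance-regular if the numbers `c_i(u, v)`, `a_i(u, v)` and
`b_i(u, v)` depend only on the distance `i` of `u` and `v`. -/
def IsDistanceRegular : Prop :=
  G.Connected ∧ ∀ u v u' v' : V, G.dist u v = G.dist u' v' →
    G.interC u v = G.interC u' v' ∧ G.interA u v = G.interA u' v' ∧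
      G.interB u v = G.interB u' v'

/-- A generalized Odd graph: a distance-regular graph with diameter `D` and odd-girth `2 D + 1`. -/
def IsGeneralizedOdd : Prop :=
  G.IsDistanceRegular ∧ G.oddGirth = ((2 * G.diam + 1 : ℕ) : ℕ∞)

end Combinatorial

end SimpleGraph

end

open scoped Matrix

set_option linter.unusedSectionVars false

/-! Let `q_i` be the monic orthogonal polynomials. The inner product is definite in degree at most
`d`, and `q_{d+1}` is the minimal polynomial `∏ (x - λ_j)`. Comparing subleading coefficients of `x
q_i` and `q_{i+1}` writes `α_i` as a difference; telescoping gives `∑ α_i = ∑ λ_i`. Evaluating the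
last recurrence at `λ₀` gives `γ_d + α_d = λ₀`. Hence `γ_d = -(λ₁ + ⋯ + λ_d) + ∑_{i<d} α_i`
(`preintersectionGamma_eq`), so the inequality is immediate, and equality under nonnegativity means
`α_i = 0` for all `i < d`.

These vanishings are combinatorial: if `α_j = 0` for `j < i`, then `q_i` has the parity of `i`, and
if moreover no odd closed walk is shorter than `2i + 1`, then `α_i` is a nonzero multiple of `tr
A^(2i+1)` (`preintersectionAlpha_eq_zero_iff`). So equality forces odd-girth at least `2d + 1`. In
(ii) the girth already kills all these `α_i` except `α_{d-1}`, and equality kills that one.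

Odd-girth at least `2d + 1` then gives distance-regularity: running the recurrence downwards from
`q_{d+1}(A) = 0`, each `q_i(A)` is supported on the pairs at distance `i`. The graph is regular, so
some polynomial in `A` is a nonzero constant matrix, which makes each `q_i(A)` constant and nonzero
on its support; the entries of `A q_i(A)` then count neighbours. Conversely, a distance-regular
graph of diameter `D` has at most `D + 1` distinct eigenvalues, so `d ≤ D` and odd-girth `2D + 1`
annihilates every `α_i` with `i < d`. -/

namespace SimpleGraph

/-! ### Spectrum of the adjacency matrix and the trace inner product -/

section SpectralTheory

variable {V : Type*} [Fintype V] [DecidableEq V] (G : SimpleGraph V) [DecidableRel G.Adj]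

/-- Evaluation of a real polynomial at the adjacency matrix. -/
noncomputable abbrev adjEval (p : ℝ[X]) : Matrix V V ℝ := aeval (G.adjMatrix ℝ) p

theorem isHermitian_adjMatrix_real : (G.adjMatrix ℝ).IsHermitian := by
  rw [Matrix.IsHermitian, Matrix.conjTranspose_eq_transpose_of_trivial, transpose_adjMatrix]

theorem transpose_adjEval (p : ℝ[X]) : (G.adjEval p)ᵀ = G.adjEval p := by
  induction p using Polynomial.induction_on' with
  | add p q hp hq => simp only [adjEval, map_add, Matrix.transpose_add] at *; rw [hp, hq]
  | monomial n a =>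
    simp [adjEval, aeval_monomial, Matrix.transpose_pow, Algebra.algebraMap_eq_smul_one]

theorem adjEval_mulVec {v : V → ℝ} {μ : ℝ} (h : G.adjMatrix ℝ *ᵥ v = μ • v) (p : ℝ[X]) :
    G.adjEval p *ᵥ v = p.eval μ • v := by
  induction p using Polynomial.induction_on with
  | C a => simp [adjEval, Algebra.algebraMap_eq_smul_one, Matrix.smul_mulVec]
  | add p q hp hq => simp only [adjEval, map_add, Matrix.add_mulVec, eval_add, add_smul] at *
                     rw [hp, hq]
  | monomial n a ih =>
    have : (C a * X ^ (n + 1) : ℝ[X]) = C a * X ^ n * X := by ring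
    rw [this, adjEval, map_mul, aeval_X, ← Matrix.mulVec_mulVec, h, Matrix.mulVec_smul, ih,
      smul_smul, eval_mul_X, mul_comm]

theorem mem_distinctEigenvalues {μ : ℝ} :
    μ ∈ G.distinctEigenvalues ↔ ∃ v : V → ℝ, v ≠ 0 ∧ G.adjMatrix ℝ *ᵥ v = μ • v := by
  rw [distinctEigenvalues, Multiset.mem_toFinset,
    mem_roots (Matrix.charpoly_monic _).ne_zero, ← Matrix.mem_spectrum_iff_isRoot_charpoly,
    ← Matrix.spectrum_toLin', ← Module.End.hasEigenvalue_iff_mem_spectrum]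
  constructor
  · intro h
    obtain ⟨v, hv⟩ := h.exists_hasEigenvector
    exact ⟨v, hv.2, by simpa using hv.apply_eq_smul⟩
  · rintro ⟨v, hv, h⟩
    exact Module.End.hasEigenvalue_of_hasEigenvector
      (Module.End.hasEigenvector_iff.mpr ⟨Module.End.mem_eigenspace_iff.mpr (by simpa using h), hv⟩)

/-- The monic polynomial whose simple roots are the eigenvalues of the adjacency matrix. -/
noncomputable def eigenvaluePoly : ℝ[X] := ∏ μ ∈ G.distinctEigenvalues, (X - C μ)

theorem eigenvaluePoly_monic : G.eigenvaluePoly.Monic := monic_prod_X_sub_C _ _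

theorem natDegree_eigenvaluePoly : G.eigenvaluePoly.natDegree = G.distinctEigenvalues.card := by
  simp [eigenvaluePoly]

theorem eval_eigenvaluePoly {μ : ℝ} (h : μ ∈ G.distinctEigenvalues) :
    G.eigenvaluePoly.eval μ = 0 := by
  rw [eigenvaluePoly, eval_prod]
  exact Finset.prod_eq_zero h (by simp)

/-- The symmetric matrix `A` has an eigenvector basis, and each of its vectors is annihilated. -/
theorem adjEval_eigenvaluePoly : G.adjEval G.eigenvaluePoly = 0 := by
  have hA := G.isHermitian_adjMatrix_real
  have key : ∀ j, G.adjEval G.eigenvaluePoly *ᵥ ⇑(hA.eigenvectorBasis j) = 0 := by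
    intro j
    have h1 := hA.mulVec_eigenvectorBasis j
    rw [G.adjEval_mulVec h1, G.eval_eigenvaluePoly, zero_smul]
    rw [mem_distinctEigenvalues]
    refine ⟨_, ?_, h1⟩
    intro h0
    have h2 := hA.eigenvectorBasis.orthonormal.ne_zero j
    exact h2 (by ext i; exact congrFun h0 i)
  have : Matrix.toEuclideanLin (G.adjEval G.eigenvaluePoly) = 0 := by
    apply hA.eigenvectorBasis.toBasis.ext
    intro j
    ext i
    simpa [Matrix.toLpLin_apply] using congrFun (key j) i
  simpa using this

theorem eq_zero_of_adjEval_eq_zero {p : ℝ[X]} (h : G.adjEval p = 0)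
    (hp : p.natDegree < G.distinctEigenvalues.card) : p = 0 := by
  apply Polynomial.eq_zero_of_natDegree_lt_card_of_eval_eq_zero' p G.distinctEigenvalues _ hp
  intro μ hμ
  obtain ⟨v, hv, hμ⟩ := (G.mem_distinctEigenvalues).1 hμ
  have := G.adjEval_mulVec hμ p
  rw [h, Matrix.zero_mulVec] at this
  exact (smul_eq_zero.1 this.symm).resolve_right hv

theorem exists_degree_lt_adjEval_eq (p : ℝ[X]) :
    ∃ r : ℝ[X], r.degree < G.distinctEigenvalues.card ∧ G.adjEval r = G.adjEval p := by
  refine ⟨p %ₘ G.eigenvaluePoly, ?_, ?_⟩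
  · refine (degree_modByMonic_lt p G.eigenvaluePoly_monic).trans_le ?_
    rw [← natDegree_eigenvaluePoly]; exact degree_le_natDegree
  · conv_rhs => rw [← modByMonic_add_div p G.eigenvaluePoly]
    simp only [adjEval, map_add, map_mul]
    rw [show aeval (G.adjMatrix ℝ) G.eigenvaluePoly = 0 from G.adjEval_eigenvaluePoly]
    simp

theorem distinctEigenvalue_zero_mem (h : G.distinctEigenvalues.Nonempty) :
    G.distinctEigenvalue 0 ∈ G.distinctEigenvalues := by
  have hl : 0 < (G.distinctEigenvalues.sort (· ≥ ·)).length := by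
    rw [Finset.length_sort]; exact h.card_pos
  rw [distinctEigenvalue, List.getD_eq_getElem _ _ hl,
    ← Finset.mem_sort (s := G.distinctEigenvalues) (· ≥ ·)]
  exact List.getElem_mem hl

theorem le_distinctEigenvalue_zero {μ : ℝ} (h : μ ∈ G.distinctEigenvalues) :
    μ ≤ G.distinctEigenvalue 0 := by
  rw [← Finset.mem_sort (· ≥ ·)] at h
  obtain ⟨i, hi, rfl⟩ := List.getElem_of_mem h
  have hs := Finset.pairwise_sort G.distinctEigenvalues (· ≥ ·)
  rw [distinctEigenvalue, List.getD_eq_getElem _ _ (by omega)]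
  rcases Nat.eq_zero_or_pos i with rfl | hpos
  · exact le_rfl
  · exact List.pairwise_iff_getElem.1 hs 0 i (by omega) hi hpos

theorem sum_range_distinctEigenvalue :
    ∑ i ∈ Finset.range G.distinctEigenvalues.card, G.distinctEigenvalue i =
      ∑ μ ∈ G.distinctEigenvalues, μ := by
  have h1 : ∑ μ ∈ G.distinctEigenvalues, μ = (G.distinctEigenvalues.sort (· ≥ ·)).sum := by
    rw [← Multiset.sum_coe, Finset.sort_eq, Finset.sum_eq_multiset_sum, Multiset.map_id']
  rw [h1, ← Finset.length_sort (s := G.distinctEigenvalues) (· ≥ ·), Finset.sum_range,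
    ← Fin.sum_univ_getElem]
  refine Finset.sum_congr rfl fun i _ => ?_
  rw [distinctEigenvalue, List.getD_eq_getElem _ _ i.2]

theorem posSemidef_sub_adjMatrix :
    (algebraMap ℝ (Matrix V V ℝ) (G.distinctEigenvalue 0) - G.adjMatrix ℝ).PosSemidef := by
  rw [Matrix.posSemidef_iff_isHermitian_and_spectrum_nonneg]
  refine ⟨?_, ?_⟩
  · apply Matrix.IsHermitian.sub _ G.isHermitian_adjMatrix_real
    rw [Matrix.algebraMap_eq_diagonal]
    exact Matrix.isHermitian_diagonal _
  · rw [← spectrum.singleton_sub_eq]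
    rintro x ⟨a, ha, b, hb, rfl⟩
    simp only [Set.mem_singleton_iff] at ha
    subst ha
    rw [Matrix.mem_spectrum_iff_isRoot_charpoly] at hb
    have : b ∈ G.distinctEigenvalues := by
      rw [distinctEigenvalues, Multiset.mem_toFinset, mem_roots (Matrix.charpoly_monic _).ne_zero]
      exact hb
    simpa using G.le_distinctEigenvalue_zero this

/-! ### The scalar product -/

theorem spectralInner_comm (p q : ℝ[X]) : G.spectralInner p q = G.spectralInner q p := by
  rw [spectralInner, spectralInner, Matrix.trace_mul_comm]

theorem spectralInner_add_left (p q r : ℝ[X]) :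
    G.spectralInner (p + q) r = G.spectralInner p r + G.spectralInner q r := by
  simp [spectralInner, add_mul, add_div]

theorem spectralInner_sub_left (p q r : ℝ[X]) :
    G.spectralInner (p - q) r = G.spectralInner p r - G.spectralInner q r := by
  simp [spectralInner, sub_mul, sub_div]

theorem spectralInner_C_mul_left (a : ℝ) (p q : ℝ[X]) :
    G.spectralInner (C a * p) q = a * G.spectralInner p q := by
  simp [spectralInner, ← Algebra.smul_def, mul_div_assoc]

theorem spectralInner_C_mul_right (a : ℝ) (p q : ℝ[X]) :
    G.spectralInner p (C a * q) = a * G.spectralInner p q := by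
  rw [spectralInner_comm, spectralInner_C_mul_left, spectralInner_comm]

theorem spectralInner_sum_left {ι : Type*} (s : Finset ι) (f : ι → ℝ[X]) (q : ℝ[X]) :
    G.spectralInner (∑ i ∈ s, f i) q = ∑ i ∈ s, G.spectralInner (f i) q := by
  simp [spectralInner, Finset.sum_mul, Finset.sum_div]

theorem spectralInner_mul_left (p q r : ℝ[X]) :
    G.spectralInner (p * q) r = G.spectralInner q (p * r) := by
  simp only [spectralInner, ← map_mul]
  congr 3; ring

theorem spectralInner_eq_zero_of_adjEval {p : ℝ[X]} (h : G.adjEval p = 0) (q : ℝ[X]) :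
    G.spectralInner p q = 0 := by
  rw [spectralInner, show aeval (G.adjMatrix ℝ) p = 0 from h]; simp

theorem spectralInner_self_eq_zero [Nonempty V] {p : ℝ[X]} :
    G.spectralInner p p = 0 ↔ G.adjEval p = 0 := by
  have h := Matrix.trace_conjTranspose_mul_self_eq_zero_iff (A := G.adjEval p)
  rw [Matrix.conjTranspose_eq_transpose_of_trivial, transpose_adjEval] at h
  rw [spectralInner, div_eq_zero_iff, h]
  simp

end SpectralTheory

/-! ### Degrees and span of the monic orthogonal polynomials -/

section OrthogonalPolynomials

variable {V : Type*} [Fintype V] [DecidableEq V] (G : SimpleGraph V) [DecidableRel G.Adj]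

theorem monicOrthPoly_eq (i : ℕ) :
    G.monicOrthPoly i = X ^ i - ∑ j ∈ Finset.range i,
      C (G.spectralInner (X ^ i) (G.monicOrthPoly j) /
          G.spectralInner (G.monicOrthPoly j) (G.monicOrthPoly j)) * G.monicOrthPoly j := by
  rw [monicOrthPoly, Finset.sum_range]

theorem monicOrthPoly_zero : G.monicOrthPoly 0 = 1 := by
  rw [monicOrthPoly_eq]; simp

theorem degree_monicOrthPoly_sub_lt (i : ℕ) : (X ^ i - G.monicOrthPoly i).degree < (i : WithBot ℕ) := by
  induction i using Nat.strong_induction_on with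
  | _ i ih =>
    rw [monicOrthPoly_eq, sub_sub_cancel, ← mem_degreeLT]
    refine Submodule.sum_mem _ fun j hj => ?_
    rw [Finset.mem_range] at hj
    rw [← smul_eq_C_mul]
    refine Submodule.smul_mem _ _ ?_
    have h1 : G.monicOrthPoly j = X ^ j - (X ^ j - G.monicOrthPoly j) := by ring
    rw [h1]
    refine Submodule.sub_mem _ ?_ ?_
    · rw [mem_degreeLT]; simpa using hj
    · rw [mem_degreeLT]; exact (ih j hj).trans (by exact_mod_cast hj)

theorem coeff_monicOrthPoly_self (i : ℕ) : (G.monicOrthPoly i).coeff i = 1 := by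
  have h := (degree_lt_iff_coeff_zero _ _).1 (G.degree_monicOrthPoly_sub_lt i) i le_rfl
  simp only [coeff_sub, coeff_X_pow_self] at h
  linarith

theorem coeff_monicOrthPoly_of_lt {i j : ℕ} (hij : i < j) : (G.monicOrthPoly i).coeff j = 0 := by
  have h := (degree_lt_iff_coeff_zero _ _).1 (G.degree_monicOrthPoly_sub_lt i) j hij.le
  simp only [coeff_sub, coeff_X_pow, hij.ne', if_false] at h
  linarith

theorem natDegree_monicOrthPoly (i : ℕ) : (G.monicOrthPoly i).natDegree = i := by
  apply natDegree_eq_of_le_of_coeff_ne_zero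
  · exact natDegree_le_iff_coeff_eq_zero.2 fun j hj => G.coeff_monicOrthPoly_of_lt hj
  · rw [coeff_monicOrthPoly_self]; exact one_ne_zero

theorem monicOrthPoly_ne_zero (i : ℕ) : G.monicOrthPoly i ≠ 0 := fun h => by
  have := G.coeff_monicOrthPoly_self i
  simp [h] at this

theorem monicOrthPoly_monic (i : ℕ) : (G.monicOrthPoly i).Monic := by
  rw [Monic, leadingCoeff, natDegree_monicOrthPoly, coeff_monicOrthPoly_self]

theorem degreeLT_le_of_monicOrthPoly_mem {S : Submodule ℝ ℝ[X]} {i : ℕ}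
    (h : ∀ j < i, G.monicOrthPoly j ∈ S) : degreeLT ℝ i ≤ S := by
  induction i with
  | zero =>
    intro p hp
    rw [mem_degreeLT] at hp
    have : p = 0 := degree_eq_bot.1 (by simpa [Nat.WithBot.lt_zero_iff] using hp)
    rw [this]; exact S.zero_mem
  | succ i ih =>
    intro p hp
    rw [mem_degreeLT, degree_lt_iff_coeff_zero] at hp
    have h1 : p - p.coeff i • G.monicOrthPoly i ∈ S := by
      apply ih fun j hj => h j (by omega)
      rw [mem_degreeLT, degree_lt_iff_coeff_zero]
      intro m hm
      rw [coeff_sub, coeff_smul]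
      rcases hm.eq_or_lt with rfl | hlt
      · simp [coeff_monicOrthPoly_self]
      · simp [G.coeff_monicOrthPoly_of_lt hlt, hp m hlt]
    have h2 := S.add_mem h1 (S.smul_mem (p.coeff i) (h i (by omega)))
    simpa using h2

variable {G} {d : ℕ} (hd : G.distinctEigenvalues.card = d + 1)

include hd in
theorem nonempty_of_card_distinctEigenvalues : Nonempty V := by
  by_contra h
  rw [not_nonempty_iff] at h
  obtain ⟨μ, hμ⟩ := Finset.card_pos.1 (by omega : 0 < G.distinctEigenvalues.card)
  obtain ⟨v, hv, -⟩ := G.mem_distinctEigenvalues.1 hμ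
  exact hv (Subsingleton.elim _ _)

end OrthogonalPolynomials

/-! ### Orthogonality, the three-term recurrence and the formula for `γ_d` -/

section Orthogonality

variable {V : Type*} [Fintype V] [DecidableEq V] {G : SimpleGraph V} [DecidableRel G.Adj]
  {d : ℕ} (hd : G.distinctEigenvalues.card = d + 1)

include hd

theorem spectralInner_monicOrthPoly_self_ne_zero {i : ℕ} (hi : i ≤ d) :
    G.spectralInner (G.monicOrthPoly i) (G.monicOrthPoly i) ≠ 0 := by
  have := nonempty_of_card_distinctEigenvalues hd
  rw [Ne, spectralInner_self_eq_zero]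
  intro h
  refine G.monicOrthPoly_ne_zero i (G.eq_zero_of_adjEval_eq_zero h ?_)
  rw [natDegree_monicOrthPoly]; omega

/-- The index `d + 1` is allowed because Gram-Schmidt at step `i` divides only by norms of index
below `i`. -/
theorem spectralInner_monicOrthPoly_of_lt {i j : ℕ} (hi : i ≤ d + 1) (hj : j < i) :
    G.spectralInner (G.monicOrthPoly i) (G.monicOrthPoly j) = 0 := by
  induction i using Nat.strong_induction_on generalizing j with
  | _ i ih =>
    rw [monicOrthPoly_eq G i, spectralInner_sub_left, spectralInner_sum_left,
      Finset.sum_eq_single_of_mem j (Finset.mem_range.2 hj)]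
    · rw [spectralInner_C_mul_left,
        div_mul_cancel₀ _ (spectralInner_monicOrthPoly_self_ne_zero hd (by omega)), sub_self]
    · intro k hk hkj
      rw [Finset.mem_range] at hk
      rw [spectralInner_C_mul_left]
      rcases lt_or_gt_of_ne hkj with h | h
      · rw [G.spectralInner_comm (G.monicOrthPoly k) (G.monicOrthPoly j), ih j hj (by omega) h, mul_zero]
      · rw [ih k hk (by omega) h, mul_zero]

theorem spectralInner_monicOrthPoly_of_degree_lt {i : ℕ} (hi : i ≤ d + 1) {p : ℝ[X]}
    (hp : p.degree < (i : WithBot ℕ)) : G.spectralInner (G.monicOrthPoly i) p = 0 := by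
  let S : Submodule ℝ ℝ[X] :=
    { carrier := {p | G.spectralInner p (G.monicOrthPoly i) = 0}
      add_mem' := fun {a b} ha hb => by
        simp only [Set.mem_ofPred_eq] at *; rw [spectralInner_add_left, ha, hb, add_zero]
      zero_mem' := by simp [spectralInner]
      smul_mem' := fun c x hx => by
        simp only [Set.mem_ofPred_eq] at *
        rw [smul_eq_C_mul, spectralInner_C_mul_left, hx, mul_zero] }
  have h : degreeLT ℝ i ≤ S := G.degreeLT_le_of_monicOrthPoly_mem fun j hj => by
    change G.spectralInner _ _ = 0
    rw [spectralInner_comm, spectralInner_monicOrthPoly_of_lt hd hi hj]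
  rw [spectralInner_comm]
  exact h (mem_degreeLT.2 hp)

theorem eq_zero_of_spectralInner_monicOrthPoly_eq_zero {i : ℕ} (hi : i ≤ d + 1) {p : ℝ[X]}
    (hp : p.degree < (i : WithBot ℕ)) (h : ∀ j < i, G.spectralInner p (G.monicOrthPoly j) = 0) :
    p = 0 := by
  have := nonempty_of_card_distinctEigenvalues hd
  by_contra h0
  refine h0 (G.eq_zero_of_adjEval_eq_zero ?_ ?_)
  · rw [← spectralInner_self_eq_zero]
    let S : Submodule ℝ ℝ[X] :=
      { carrier := {q | G.spectralInner q p = 0}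
        add_mem' := fun {a b} ha hb => by
          simp only [Set.mem_ofPred_eq] at *; rw [spectralInner_add_left, ha, hb, add_zero]
        zero_mem' := by simp [spectralInner]
        smul_mem' := fun c x hx => by
          simp only [Set.mem_ofPred_eq] at *
          rw [smul_eq_C_mul, spectralInner_C_mul_left, hx, mul_zero] }
    have h' : degreeLT ℝ i ≤ S := G.degreeLT_le_of_monicOrthPoly_mem fun j hj => by
      change G.spectralInner _ _ = 0
      rw [spectralInner_comm, h j hj]
    exact h' (mem_degreeLT.2 hp)
  · rw [degree_eq_natDegree h0] at hp
    have : p.natDegree < i := by exact_mod_cast hp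
    omega

/-- The difference has degree at most `d`, hence is orthogonal to `q_{d+1}`; the eigenvalue
polynomial vanishes at `A`, so `q_{d+1}` has norm zero. The difference then also vanishes at `A` and
is zero by degree. -/
theorem monicOrthPoly_succ_eq_eigenvaluePoly : G.monicOrthPoly (d + 1) = G.eigenvaluePoly := by
  have := nonempty_of_card_distinctEigenvalues hd
  have hm := G.adjEval_eigenvaluePoly
  have hdeg : (G.monicOrthPoly (d + 1) - G.eigenvaluePoly).degree < ((d + 1 : ℕ) : WithBot ℕ) := by
    have h1 := degree_eq_natDegree (G.monicOrthPoly_ne_zero (d + 1))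
    rw [natDegree_monicOrthPoly] at h1
    rw [← h1]
    apply degree_sub_lt_left
    · rw [h1, degree_eq_natDegree G.eigenvaluePoly_monic.ne_zero, natDegree_eigenvaluePoly, hd]
    · exact G.monicOrthPoly_ne_zero _
    · rw [(G.monicOrthPoly_monic _).leadingCoeff, G.eigenvaluePoly_monic.leadingCoeff]
  have h0 := spectralInner_monicOrthPoly_of_degree_lt hd le_rfl hdeg
  rw [spectralInner_comm, spectralInner_sub_left, spectralInner_eq_zero_of_adjEval G hm,
    sub_zero, spectralInner_self_eq_zero] at h0
  refine sub_eq_zero.1 (G.eq_zero_of_adjEval_eq_zero ?_ ?_)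
  · simp only [adjEval, map_sub] at *
    rw [h0, hm, sub_zero]
  · rw [hd]
    by_cases hz : G.monicOrthPoly (d + 1) - G.eigenvaluePoly = 0
    · rw [hz]; simp
    · rw [degree_eq_natDegree hz] at hdeg
      exact_mod_cast hdeg

theorem adjEval_monicOrthPoly_succ : G.adjEval (G.monicOrthPoly (d + 1)) = 0 := by
  rw [monicOrthPoly_succ_eq_eigenvaluePoly hd, adjEval_eigenvaluePoly]

-- If `q_i = (x - λ₀) r`, then `⟨q_i, r⟩ = 0` because `r` has smaller degree. Factoring the positive
-- semidefinite matrix `λ₀ - A` as `Bᴴ B` turns this into `tr ((B r(A))ᴴ (B r(A))) = 0`, so `q_i(A)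
-- = 0`, a contradiction. This makes the scaling to `p_i` nondegenerate.
open scoped MatrixOrder Matrix.Norms.L2Operator in
theorem eval_monicOrthPoly_ne_zero {i : ℕ} (hi : i ≤ d) :
    (G.monicOrthPoly i).eval (G.distinctEigenvalue 0) ≠ 0 := by
  have := nonempty_of_card_distinctEigenvalues hd
  intro h
  obtain ⟨r, hr⟩ := dvd_iff_isRoot.2 h
  have hr0 : r ≠ 0 := fun h0 => G.monicOrthPoly_ne_zero i (by rw [hr, h0, mul_zero])
  have hdeg : r.degree < (i : WithBot ℕ) := by
    have h1 := G.natDegree_monicOrthPoly i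
    rw [hr, natDegree_mul (X_sub_C_ne_zero _) hr0, natDegree_X_sub_C] at h1
    rw [degree_eq_natDegree hr0]
    exact_mod_cast (by omega : r.natDegree < i)
  have h0 := spectralInner_monicOrthPoly_of_degree_lt hd (by omega) hdeg
  obtain ⟨B, hB⟩ :=
    CStarAlgebra.nonneg_iff_eq_star_mul_self.mp G.posSemidef_sub_adjMatrix.nonneg
  rw [Matrix.star_eq_conjTranspose] at hB
  have hq : G.adjEval (G.monicOrthPoly i) = -(Bᴴ * B * G.adjEval r) := by
    rw [← hB, hr]; simp only [adjEval, map_mul, map_sub, aeval_X, aeval_C]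
    rw [← neg_mul, neg_sub]
  have hz : B * G.adjEval r = 0 := by
    rw [← Matrix.trace_conjTranspose_mul_self_eq_zero_iff, Matrix.conjTranspose_mul,
      Matrix.conjTranspose_eq_transpose_of_trivial (G.adjEval r), transpose_adjEval]
    rw [spectralInner, show aeval (G.adjMatrix ℝ) (G.monicOrthPoly i) = _ from hq,
      Matrix.neg_mul, Matrix.trace_neg, div_eq_zero_iff, neg_eq_zero,
      Matrix.trace_mul_comm] at h0
    rw [Matrix.mul_assoc, ← Matrix.mul_assoc Bᴴ]
    exact h0.resolve_right (by simp)
  refine spectralInner_monicOrthPoly_self_ne_zero hd hi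
    (G.spectralInner_eq_zero_of_adjEval ?_ _)
  rw [hq, Matrix.mul_assoc, hz, Matrix.mul_zero, neg_zero]

theorem predistancePoly_eq_C_mul {i : ℕ} (hi : i ≤ d) :
    ∃ c : ℝ, c ≠ 0 ∧ G.predistancePoly i = C c * G.monicOrthPoly i ∧
      c = (G.monicOrthPoly i).eval (G.distinctEigenvalue 0) /
        G.spectralInner (G.monicOrthPoly i) (G.monicOrthPoly i) :=
  ⟨_, div_ne_zero (eval_monicOrthPoly_ne_zero hd hi)
    (spectralInner_monicOrthPoly_self_ne_zero hd hi), rfl, rfl⟩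

theorem preintersectionAlpha_mul {i : ℕ} (hi : i ≤ d) :
    G.preintersectionAlpha i * G.spectralInner (G.monicOrthPoly i) (G.monicOrthPoly i) =
      G.spectralInner (X * G.monicOrthPoly i) (G.monicOrthPoly i) := by
  obtain ⟨c, hc, h, -⟩ := predistancePoly_eq_C_mul hd hi
  have hN := spectralInner_monicOrthPoly_self_ne_zero hd hi
  rw [preintersectionAlpha, h, mul_left_comm]
  simp only [spectralInner_C_mul_left, spectralInner_C_mul_right]
  field_simp

theorem spectralInner_X_mul_monicOrthPoly_succ {i : ℕ} (hi : i ≤ d) :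
    G.spectralInner (X * G.monicOrthPoly i) (G.monicOrthPoly (i + 1)) =
      G.spectralInner (G.monicOrthPoly (i + 1)) (G.monicOrthPoly (i + 1)) := by
  rw [← sub_eq_zero, ← spectralInner_sub_left, spectralInner_comm]
  apply spectralInner_monicOrthPoly_of_degree_lt hd (by omega)
  rw [degree_lt_iff_coeff_zero]
  intro m hm
  obtain ⟨m, rfl⟩ : ∃ k, m = k + 1 := ⟨m - 1, by omega⟩
  rw [coeff_sub, coeff_X_mul]
  rcases hm.eq_or_lt with h | h
  · obtain rfl : i = m := by omega
    simp [coeff_monicOrthPoly_self]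
  · rw [coeff_monicOrthPoly_of_lt G (by omega), coeff_monicOrthPoly_of_lt G (by omega), sub_zero]

/-- `x q_i - q_{i+1}` has degree at most `i`, so its `q_i`-component is its coefficient at `x^i`.
Multiplying by `X` on the right-hand side avoids the index `i - 1` and makes the difference
telescope. -/
theorem preintersectionAlpha_eq {i : ℕ} (hi : i ≤ d) :
    G.preintersectionAlpha i =
      (X * G.monicOrthPoly i).coeff i - (X * G.monicOrthPoly (i + 1)).coeff (i + 1) := by
  have hN := spectralInner_monicOrthPoly_self_ne_zero hd hi
  refine mul_right_cancel₀ hN ?_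
  rw [preintersectionAlpha_mul hd hi, ← spectralInner_C_mul_left, ← sub_eq_zero,
    ← spectralInner_sub_left]
  have h := spectralInner_monicOrthPoly_of_lt hd (by omega : i + 1 ≤ d + 1) (Nat.lt_succ_self i)
  refine (sub_eq_zero.1 ?_).trans h
  rw [← spectralInner_sub_left, spectralInner_comm]
  apply spectralInner_monicOrthPoly_of_degree_lt hd (by omega)
  rw [degree_lt_iff_coeff_zero]
  intro m hm
  rw [coeff_sub, coeff_sub, coeff_C_mul]
  rcases hm.eq_or_lt with rfl | hlt
  · rw [coeff_monicOrthPoly_self, coeff_X_mul]; ring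
  · obtain ⟨m, rfl⟩ : ∃ k, m = k + 1 := ⟨m - 1, by omega⟩
    rw [coeff_X_mul, coeff_monicOrthPoly_of_lt G hlt]
    rcases (Nat.le_of_lt_succ hlt).eq_or_lt with rfl | h'
    · simp [coeff_monicOrthPoly_self]
    · rw [coeff_monicOrthPoly_of_lt G h', coeff_monicOrthPoly_of_lt G (by omega)]; ring

theorem sum_preintersectionAlpha :
    ∑ i ∈ Finset.range (d + 1), G.preintersectionAlpha i =
      ∑ i ∈ Finset.range (d + 1), G.distinctEigenvalue i := by
  refine (Finset.sum_congr rfl fun i hi => preintersectionAlpha_eq hd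
    (Nat.le_of_lt_succ (Finset.mem_range.1 hi))).trans
    ((Finset.sum_range_sub' (fun i => (X * G.monicOrthPoly i).coeff i) (d + 1)).trans ?_)
  rw [coeff_X_mul, monicOrthPoly_succ_eq_eigenvaluePoly hd]
  have h1 := prod_X_sub_C_nextCoeff (s := G.distinctEigenvalues) (fun μ : ℝ => μ)
  rw [← eigenvaluePoly, nextCoeff_of_natDegree_pos (by rw [natDegree_eigenvaluePoly]; omega),
    natDegree_eigenvaluePoly, hd, Nat.add_sub_cancel, ← sum_range_distinctEigenvalue, hd] at h1
  rw [h1, coeff_X_mul_zero, zero_sub, neg_neg]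

theorem degree_X_mul_monicOrthPoly_sub_lt {i : ℕ} (hi : i ≤ d) :
    (X * G.monicOrthPoly i - G.monicOrthPoly (i + 1) -
      C (G.preintersectionAlpha i) * G.monicOrthPoly i).degree < (i : WithBot ℕ) := by
  rw [degree_lt_iff_coeff_zero]
  intro m hm
  rw [coeff_sub, coeff_sub, coeff_C_mul]
  rcases hm.eq_or_lt with rfl | hlt
  · rw [coeff_monicOrthPoly_self, preintersectionAlpha_eq hd hi, coeff_X_mul]; ring
  · obtain ⟨m, rfl⟩ : ∃ k, m = k + 1 := ⟨m - 1, by omega⟩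
    rw [coeff_X_mul, coeff_monicOrthPoly_of_lt G hlt]
    rcases (Nat.le_of_lt_succ hlt).eq_or_lt with rfl | h'
    · simp [coeff_monicOrthPoly_self]
    · rw [coeff_monicOrthPoly_of_lt G h', coeff_monicOrthPoly_of_lt G (by omega)]; ring

theorem monicOrthPoly_one : G.monicOrthPoly 1 = X - C (G.preintersectionAlpha 0) := by
  have h := degree_X_mul_monicOrthPoly_sub_lt hd (Nat.zero_le d)
  have h0 := degree_eq_bot.1 (by simpa [Nat.WithBot.lt_zero_iff] using h)
  rw [monicOrthPoly_zero, mul_one, mul_one] at h0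
  linear_combination -h0

/-- The remainder has degree at most `i` and is orthogonal to `q_0, …, q_i`. At `i + 1 = d` the
leading term is the minimal polynomial, so no reduction modulo it is needed. -/
theorem X_mul_monicOrthPoly_succ {i : ℕ} (hi : i + 1 ≤ d) :
    X * G.monicOrthPoly (i + 1) = G.monicOrthPoly (i + 2) +
      C (G.preintersectionAlpha (i + 1)) * G.monicOrthPoly (i + 1) +
      C (G.spectralInner (G.monicOrthPoly (i + 1)) (G.monicOrthPoly (i + 1)) /
        G.spectralInner (G.monicOrthPoly i) (G.monicOrthPoly i)) * G.monicOrthPoly i := by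
  have hN := spectralInner_monicOrthPoly_self_ne_zero hd (by omega : i ≤ d)
  rw [← sub_eq_zero, ← sub_sub, ← sub_sub]
  apply eq_zero_of_spectralInner_monicOrthPoly_eq_zero hd (by omega : i + 1 ≤ d + 1)
  · refine (degree_sub_le _ _).trans_lt (max_lt (degree_X_mul_monicOrthPoly_sub_lt hd hi) ?_)
    rw [degree_lt_iff_coeff_zero]
    intro m hm
    rw [coeff_C_mul, coeff_monicOrthPoly_of_lt G (by omega), mul_zero]
  · intro j hj
    simp only [spectralInner_sub_left, spectralInner_C_mul_left]
    rw [spectralInner_monicOrthPoly_of_lt hd (by omega) (by omega : j < i + 2),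
      spectralInner_monicOrthPoly_of_lt hd (by omega) (by omega : j < i + 1),
      spectralInner_mul_left]
    rcases (Nat.le_of_lt_succ hj).eq_or_lt with rfl | h
    · rw [spectralInner_comm, spectralInner_X_mul_monicOrthPoly_succ hd (by omega)]
      field_simp; ring
    · rw [spectralInner_monicOrthPoly_of_degree_lt hd (by omega),
        spectralInner_monicOrthPoly_of_lt hd (by omega) h]
      · ring
      · rw [degree_lt_iff_coeff_zero]
        intro m hm
        obtain ⟨m, rfl⟩ : ∃ k, m = k + 1 := ⟨m - 1, by omega⟩
        rw [coeff_X_mul, coeff_monicOrthPoly_of_lt G (by omega)]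

theorem distinctEigenvalue_zero_mem_of_card : G.distinctEigenvalue 0 ∈ G.distinctEigenvalues :=
  G.distinctEigenvalue_zero_mem (Finset.card_pos.1 (by omega))

theorem preintersectionGamma_add_preintersectionAlpha (hpos : 0 < d) :
    G.preintersectionGamma d + G.preintersectionAlpha d = G.distinctEigenvalue 0 := by
  obtain ⟨e, rfl⟩ : ∃ e, d = e + 1 := ⟨d - 1, by omega⟩
  obtain ⟨c, hc, h, hc'⟩ := predistancePoly_eq_C_mul hd (by omega : e ≤ e + 1)
  obtain ⟨c₁, hc₁, h₁, hc₁'⟩ := predistancePoly_eq_C_mul hd (le_refl (e + 1))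
  have hN := spectralInner_monicOrthPoly_self_ne_zero hd (by omega : e ≤ e + 1)
  have hN₁ := spectralInner_monicOrthPoly_self_ne_zero hd (le_refl (e + 1))
  have hl := eval_monicOrthPoly_ne_zero hd (le_refl (e + 1))
  have hg : G.preintersectionGamma (e + 1) = c / c₁ := by
    rw [preintersectionGamma, h, h₁, mul_left_comm]
    simp only [spectralInner_C_mul_left, spectralInner_C_mul_right]
    rw [spectralInner_X_mul_monicOrthPoly_succ hd (by omega)]
    field_simp
  have h3 := congrArg (eval (G.distinctEigenvalue 0)) (X_mul_monicOrthPoly_succ hd le_rfl)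
  have h0 := G.eval_eigenvaluePoly (distinctEigenvalue_zero_mem_of_card hd)
  rw [← monicOrthPoly_succ_eq_eigenvaluePoly hd] at h0
  simp only [eval_mul, eval_add, eval_X, eval_C, h0] at h3
  rw [hg, hc', hc₁']
  field_simp at h3 ⊢
  linear_combination -h3

theorem preintersectionGamma_eq (hpos : 0 < d) :
    G.preintersectionGamma d = -(∑ i ∈ Finset.Icc 1 d, G.distinctEigenvalue i) +
      ∑ i ∈ Finset.range d, G.preintersectionAlpha i := by
  have h1 := preintersectionGamma_add_preintersectionAlpha hd hpos
  have h2 := sum_preintersectionAlpha hd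
  rw [Finset.sum_range_succ, Finset.sum_range_succ' G.distinctEigenvalue,
    Finset.range_eq_Ico, Finset.sum_Ico_add' G.distinctEigenvalue 0 d 1] at h2
  change _ = ∑ i ∈ Finset.Ico 1 (d + 1), _ + _ at h2
  rw [Finset.Ico_add_one_right_eq_Icc] at h2
  rw [Finset.range_eq_Ico]
  linarith

end Orthogonality

/-! ### Odd closed walks, odd cycles and parity of distances -/

section OddClosedWalks

variable {V : Type*} {G : SimpleGraph V}

theorem Walk.exists_closed_subwalk_of_not_isPath {u v : V} (p : G.Walk u v) (hp : ¬ p.IsPath) :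
    ∃ (x : V) (a : G.Walk u x) (c : G.Walk x x) (b : G.Walk x v),
      0 < c.length ∧ p.length = a.length + c.length + b.length := by
  classical
  induction p with
  | nil => exact absurd Walk.IsPath.nil hp
  | @cons u w v h q ih =>
    by_cases hq : q.IsPath
    · have hu : u ∈ q.support := by
        by_contra hu
        exact hp (hq.cons hu)
      refine ⟨u, Walk.nil, Walk.cons h (q.takeUntil u hu), q.dropUntil u hu, by simp, ?_⟩
      have := congrArg Walk.length (q.take_spec hu)
      rw [Walk.length_append] at this
      simp only [Walk.length_nil, Walk.length_cons]
      omega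
    · obtain ⟨x, a, c, b, hc, hl⟩ := ih hq
      exact ⟨x, Walk.cons h a, c, b, hc, by simp only [Walk.length_cons]; omega⟩

/-- Cutting out a closed subwalk leaves two shorter closed walks, one of them odd. This lets
odd-girth be read off from closed walks, which are what traces of powers count. -/
theorem Walk.exists_odd_isCycle {v : V} (w : G.Walk v v) (hw : Odd w.length) :
    ∃ (u : V) (c : G.Walk u u), (c.IsCycle ∧ Odd c.length) ∧ c.length ≤ w.length := by
  induction h : w.length using Nat.strong_induction_on generalizing v w with
  | _ n ih =>
    subst h
    cases w with
    | nil => simp at hw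
    | @cons _ x _ h p =>
      by_cases hp : p.IsPath
      · refine ⟨v, Walk.cons h p, ⟨?_, hw⟩, le_rfl⟩
        rw [Walk.cons_isCycle_iff]
        refine ⟨hp, fun he => ?_⟩
        -- A path reusing the first edge is that edge alone, giving a closed walk of even length 2.
        have h1 : p.length = 1 := by
          have h2 : 0 < p.length := by rw [← Walk.length_edges]; exact List.length_pos_of_mem he
          have h3 := hp.eq_snd_of_mem_edges (Sym2.eq_swap ▸ he)
          exact ((hp.getVert_eq_end_iff h2).1 h3.symm).symm
        rw [Walk.length_cons, h1] at hw
        exact absurd hw (by decide)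
      · obtain ⟨y, a, c, b, hc, hl⟩ := p.exists_closed_subwalk_of_not_isPath hp
        rw [Walk.length_cons] at hw
        rcases Nat.even_or_odd c.length with hce | hco
        · obtain ⟨u, c', h', hle⟩ := ih (Walk.cons h (a.append b)).length
            (by simp only [Walk.length_cons, Walk.length_append]; omega)
            (Walk.cons h (a.append b))
            (by simp only [Walk.length_cons, Walk.length_append]; grind) rfl
          refine ⟨u, c', h', hle.trans ?_⟩
          simp only [Walk.length_cons, Walk.length_append]; omega
        · obtain ⟨u, c', h', hle⟩ := ih c.length (by simp only [Walk.length_cons]; omega) c hco rfl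
          exact ⟨u, c', h', hle.trans (by simp only [Walk.length_cons]; omega)⟩

theorem le_oddGirth_iff {m : ℕ} :
    (m : ℕ∞) ≤ G.oddGirth ↔ ∀ (v : V) (w : G.Walk v v), Odd w.length → m ≤ w.length := by
  constructor
  · intro h v w hw
    obtain ⟨u, c, hc, hle⟩ := w.exists_odd_isCycle hw
    have : (m : ℕ∞) ≤ c.length := h.trans (iInf_le_of_le u (iInf_le_of_le c (iInf_le _ hc)))
    exact (Nat.cast_le.1 this).trans hle
  · intro h
    exact le_iInf fun v => le_iInf fun w => le_iInf fun hw => Nat.cast_le.2 (h v w hw.2)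

/-- Otherwise the parity of the distance from a fixed vertex would be a proper 2-colouring. -/
theorem exists_adj_dist_eq_of_not_isBipartite [Nonempty V] (h : ¬ G.IsBipartite) :
    ∃ r u v : V, G.Adj u v ∧ G.dist r u = G.dist r v := by
  by_contra hcon
  push Not at hcon
  obtain ⟨r⟩ := ‹Nonempty V›
  refine h ⟨fun v => if Even (G.dist r v) then 0 else 1, ?_⟩
  intro a b hab
  have h1 := hcon r a b hab
  have h2 := hab.diff_dist_adj (u := r)
  simp only [top_adj]
  grind

theorem Connected.exists_odd_closed_walk (hconn : G.Connected) (h : ¬ G.IsBipartite) :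
    ∃ (r u v : V) (w : G.Walk r r), G.Adj u v ∧ w.length = 2 * G.dist r u + 1 := by
  have := hconn.nonempty
  obtain ⟨r, u, v, hadj, hd⟩ := exists_adj_dist_eq_of_not_isBipartite h
  obtain ⟨p, hp⟩ := hconn.exists_walk_length_eq_dist r u
  obtain ⟨q, hq⟩ := hconn.exists_walk_length_eq_dist v r
  refine ⟨r, u, v, p.append (Walk.cons hadj q), hadj, ?_⟩
  rw [Walk.length_append, Walk.length_cons, hp, hq, dist_comm (u := v), ← hd]
  omega

/-- Closing the walk with a geodesic yields a closed walk too short to be odd. -/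
theorem Connected.even_add_dist_of_walk (hconn : G.Connected) {m : ℕ}
    (hodd : ∀ (v : V) (w : G.Walk v v), Odd w.length → m ≤ w.length) {u v : V} (p : G.Walk u v)
    (hp : p.length + G.dist u v < m) : Even (p.length + G.dist u v) := by
  obtain ⟨q, hq⟩ := hconn.exists_walk_length_eq_dist v u
  rw [dist_comm] at hq
  by_contra h
  have := hodd u (p.append q) (by rw [Walk.length_append, hq]; exact Nat.not_even_iff_odd.1 h)
  rw [Walk.length_append] at this
  omega

end OddClosedWalks

/-! ### Walk counts and the diameter bound -/

section AdjMatrixPowers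

variable {V : Type*} [Fintype V] [DecidableEq V] {G : SimpleGraph V} [DecidableRel G.Adj]

theorem adjMatrix_pow_apply_eq_zero_iff {k : ℕ} {u v : V} :
    (G.adjMatrix ℝ ^ k) u v = 0 ↔ ∀ p : G.Walk u v, p.length ≠ k := by
  rw [adjMatrix_pow_apply_eq_card_walk, Nat.cast_eq_zero, Fintype.card_eq_zero_iff]
  exact ⟨fun h p hp => h.elim ⟨p, hp⟩, fun h => ⟨fun p => h p.1 p.2⟩⟩

theorem trace_adjMatrix_pow_eq_zero_iff {k : ℕ} :
    (G.adjMatrix ℝ ^ k).trace = 0 ↔ ∀ (v : V) (p : G.Walk v v), p.length ≠ k := by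
  rw [Matrix.trace, Finset.sum_eq_zero_iff_of_nonneg]
  · simp [adjMatrix_pow_apply_eq_zero_iff]
  · intro v _
    rw [Matrix.diag_apply, adjMatrix_pow_apply_eq_card_walk]
    exact Nat.cast_nonneg _

theorem adjEval_apply (p : ℝ[X]) (u v : V) :
    G.adjEval p u v = ∑ k ∈ Finset.range (p.natDegree + 1),
      p.coeff k * (G.adjMatrix ℝ ^ k) u v := by
  rw [adjEval, aeval_eq_sum_range, Matrix.sum_apply]
  simp

theorem trace_adjEval (p : ℝ[X]) :
    (G.adjEval p).trace = ∑ k ∈ Finset.range (p.natDegree + 1),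
      p.coeff k * (G.adjMatrix ℝ ^ k).trace := by
  rw [adjEval, aeval_eq_sum_range, Matrix.trace_sum]
  simp

theorem adjEval_apply_eq_zero_of_natDegree_lt_dist {p : ℝ[X]} {u v : V}
    (h : p.natDegree < G.dist u v) : G.adjEval p u v = 0 := by
  rw [adjEval_apply]
  refine Finset.sum_eq_zero fun k hk => ?_
  rw [adjMatrix_pow_apply_eq_zero_iff.2, mul_zero]
  rintro q rfl
  have := dist_le q
  rw [Finset.mem_range] at hk
  omega

/-- At distance `k > d` the entry of `A^k` is nonzero, yet `A^k` is a polynomial in `A` of degree at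
most `d`, whose entry there is zero. -/
theorem Connected.dist_le_of_card_distinctEigenvalues (hconn : G.Connected) {d : ℕ}
    (hd : G.distinctEigenvalues.card = d + 1) (u v : V) : G.dist u v ≤ d := by
  by_contra! h
  have := hconn.nonempty
  obtain ⟨r, hr, he⟩ := G.exists_degree_lt_adjEval_eq (X ^ G.dist u v)
  obtain ⟨p, hp⟩ := hconn.exists_walk_length_eq_dist u v
  have h1 : G.adjEval r u v = 0 := by
    apply adjEval_apply_eq_zero_of_natDegree_lt_dist
    by_cases hr0 : r = 0
    · subst hr0; rw [natDegree_zero]; omega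
    · rw [degree_eq_natDegree hr0, hd] at hr
      have : r.natDegree < d + 1 := by exact_mod_cast hr
      omega
  rw [he, adjEval, map_pow, aeval_X] at h1
  exact adjMatrix_pow_apply_eq_zero_iff.1 h1 p hp

end AdjMatrixPowers

/-! ### Vanishing of the `α_i` and absence of short odd closed walks -/

section Parity

variable {V : Type*} [Fintype V] [DecidableEq V] {G : SimpleGraph V} [DecidableRel G.Adj]
  {d : ℕ} (hd : G.distinctEigenvalues.card = d + 1)

include hd

theorem coeff_monicOrthPoly_eq_zero_of_odd {e : ℕ} (he : e ≤ d)
    (hα : ∀ i < e, G.preintersectionAlpha i = 0) {i : ℕ} (hi : i ≤ e) {k : ℕ} (hk : Odd (i + k)) :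
    (G.monicOrthPoly i).coeff k = 0 := by
  induction i using Nat.strong_induction_on generalizing k with
  | _ i ih =>
    match i with
    | 0 =>
      rw [monicOrthPoly_zero, coeff_one, if_neg]
      rintro rfl
      exact absurd hk (by decide)
    | 1 =>
      rw [monicOrthPoly_one hd, hα 0 hi, map_zero, sub_zero, coeff_X, if_neg]
      rintro rfl
      exact absurd hk (by decide)
    | i + 2 =>
      have h3 := X_mul_monicOrthPoly_succ hd (by omega : i + 1 ≤ d)
      rw [hα (i + 1) (by omega), map_zero, zero_mul, add_zero] at h3
      have h4 := congrArg (fun p => coeff p k) h3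
      simp only [coeff_add, coeff_C_mul] at h4
      rw [ih i (by omega) (by omega) (by grind), mul_zero, add_zero] at h4
      rw [← h4]
      cases k with
      | zero => simp
      | succ k => rw [coeff_X_mul, ih (i + 1) (by omega) (by omega) (by grind)]

/-- By parity `x q_i²` is an odd monic polynomial of degree `2i + 1`, and the lower odd powers of
`A` have trace zero. So `α_i ⟨q_i, q_i⟩ = tr A^(2i+1) / n`. -/
theorem preintersectionAlpha_eq_zero_iff {i : ℕ} (hi : i ≤ d)
    (hα : ∀ j < i, G.preintersectionAlpha j = 0)
    (hodd : ∀ (v : V) (w : G.Walk v v), Odd w.length → 2 * i + 1 ≤ w.length) :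
    G.preintersectionAlpha i = 0 ↔ (G.adjMatrix ℝ ^ (2 * i + 1)).trace = 0 := by
  have := nonempty_of_card_distinctEigenvalues hd
  have hN := spectralInner_monicOrthPoly_self_ne_zero hd hi
  have hq := G.monicOrthPoly_monic i
  have hpar : ∀ k, Even k → (X * G.monicOrthPoly i * G.monicOrthPoly i).coeff k = 0 := by
    intro k hk
    rw [mul_assoc]
    cases k with
    | zero => simp
    | succ k =>
      rw [coeff_X_mul, coeff_mul]
      refine Finset.sum_eq_zero fun x hx => ?_
      rw [Finset.HasAntidiagonal.mem_antidiagonal] at hx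
      by_cases hx1 : Odd (i + x.1)
      · rw [coeff_monicOrthPoly_eq_zero_of_odd hd hi hα le_rfl hx1, zero_mul]
      · rw [coeff_monicOrthPoly_eq_zero_of_odd hd hi hα le_rfl (k := x.2) (by grind), mul_zero]
  have hm : (X * G.monicOrthPoly i * G.monicOrthPoly i).Monic := (monic_X.mul hq).mul hq
  have hdeg : (X * G.monicOrthPoly i * G.monicOrthPoly i).natDegree = 2 * i + 1 := by
    rw [(monic_X.mul hq).natDegree_mul hq, monic_X.natDegree_mul hq, natDegree_X,
      natDegree_monicOrthPoly]
    ring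
  have htr : (G.adjEval (X * G.monicOrthPoly i * G.monicOrthPoly i)).trace =
      (G.adjMatrix ℝ ^ (2 * i + 1)).trace := by
    rw [trace_adjEval, Finset.sum_range_succ, Finset.sum_eq_zero, zero_add]
    · rw [hm.coeff_natDegree, hdeg, one_mul]
    · intro k hk
      rw [Finset.mem_range, hdeg] at hk
      rcases Nat.even_or_odd k with h | h
      · rw [hpar k h, zero_mul]
      · rw [trace_adjMatrix_pow_eq_zero_iff.2, mul_zero]
        rintro v p rfl
        have := hodd v p h
        omega
  have h1 := preintersectionAlpha_mul hd hi
  rw [spectralInner.eq_1 _ (X * _), ← map_mul, show (aeval (G.adjMatrix ℝ)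
    (X * G.monicOrthPoly i * G.monicOrthPoly i)).trace = _ from htr] at h1
  have hn : (Fintype.card V : ℝ) ≠ 0 := by simp
  constructor
  · intro h
    rw [h, zero_mul, eq_comm, div_eq_zero_iff] at h1
    exact h1.resolve_right hn
  · intro h
    rw [h, zero_div] at h1
    exact (mul_eq_zero.1 h1).resolve_right hN

theorem preintersectionAlpha_eq_zero_of_odd_closed_walk {e : ℕ} (he : e ≤ d)
    (hodd : ∀ (v : V) (w : G.Walk v v), Odd w.length → 2 * e + 1 ≤ w.length) {i : ℕ} (hi : i < e) :
    G.preintersectionAlpha i = 0 := by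
  induction i using Nat.strong_induction_on with
  | _ i ih =>
    rw [preintersectionAlpha_eq_zero_iff hd (by omega) fun j hj => ih j hj (by omega)]
    · rw [trace_adjMatrix_pow_eq_zero_iff]
      intro v p hp
      have := hodd v p (by rw [hp]; exact odd_two_mul_add_one i)
      omega
    · intro v w hw
      have := hodd v w hw
      omega

theorem le_length_of_preintersectionAlpha_eq_zero {e : ℕ} (he : e ≤ d + 1)
    (hα : ∀ i < e, G.preintersectionAlpha i = 0) (v : V) (w : G.Walk v v) (hw : Odd w.length) :
    2 * e + 1 ≤ w.length := by
  induction e generalizing v w with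
  | zero => have := hw.pos; omega
  | succ e ih =>
    have ih' := ih (by omega) fun i hi => hα i (by omega)
    have h1 := (preintersectionAlpha_eq_zero_iff hd (by omega) (fun j hj => hα j (by omega))
      ih').1 (hα e (by omega))
    have h2 := trace_adjMatrix_pow_eq_zero_iff.1 h1 v w
    have h3 := ih' v w hw
    have : w.length ≠ 2 * e + 2 := by rintro h; rw [h] at hw; grind
    omega

end Parity

/-! ### Odd-girth at least `2d + 1` implies generalized Odd -/

section OddGirthTheorem

variable {V : Type*} [Fintype V] [DecidableEq V] {G : SimpleGraph V} [DecidableRel G.Adj]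

theorem adjEval_X_mul_apply (p : ℝ[X]) (u v : V) :
    G.adjEval (X * p) u v = ∑ w ∈ G.neighborFinset v, G.adjEval p u w := by
  rw [mul_comm, adjEval, map_mul, aeval_X, mul_adjMatrix_apply]

/-- For a connected `k`-regular graph, the symmetric matrices `B` with `A B = k B` are
multiples of the all-ones matrix. -/
theorem Connected.exists_const_of_adjMatrix_mul_eq_smul (hconn : G.Connected) {k : ℕ}
    (hk : G.IsRegularOfDegree k) {B : Matrix V V ℝ} (hB : Bᵀ = B)
    (h : G.adjMatrix ℝ * B = (k : ℝ) • B) : ∃ c : ℝ, ∀ u v, B u v = c := by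
  have hcol : ∀ v u u', B u v = B u' v := by
    intro v
    -- By regularity each column lies in the kernel of the Laplacian, which on a connected graph
    -- consists of the constants.
    have h1 : G.lapMatrix ℝ *ᵥ (fun u => B u v) = 0 := by
      ext u
      have := congrFun (congrFun h u) v
      rw [lapMatrix, Matrix.sub_mulVec, Pi.sub_apply, degMatrix, Matrix.mulVec_diagonal, hk u]
      rw [Matrix.smul_apply, smul_eq_mul] at this
      rw [← this, Matrix.mul_apply, Pi.zero_apply, Matrix.mulVec, dotProduct, sub_self]
    intro u u'
    exact G.lapMatrix_mulVec_eq_zero_iff_forall_reachable.1 h1 u u' (hconn.preconnected u u')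
  obtain ⟨r⟩ := hconn.nonempty
  refine ⟨B r r, fun u v => ?_⟩
  have h1 : B r v = B v r := congrFun (congrFun hB v) r
  rw [hcol v u r, h1, hcol r v r]

variable {d : ℕ} (hd : G.distinctEigenvalues.card = d + 1) (hconn : G.Connected)
  (hodd : ∀ (v : V) (w : G.Walk v v), Odd w.length → 2 * d + 1 ≤ w.length)

include hd hconn hodd

theorem adjEval_monicOrthPoly_apply_eq_zero_of_odd {i : ℕ} (hi : i ≤ d) {u v : V}
    (h : Odd (i + G.dist u v)) : G.adjEval (G.monicOrthPoly i) u v = 0 := by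
  have hα : ∀ j < d, G.preintersectionAlpha j = 0 := fun j hj =>
    preintersectionAlpha_eq_zero_of_odd_closed_walk hd le_rfl hodd hj
  have hdist := hconn.dist_le_of_card_distinctEigenvalues hd u v
  rw [adjEval_apply]
  refine Finset.sum_eq_zero fun k hk => ?_
  rw [Finset.mem_range, natDegree_monicOrthPoly] at hk
  by_cases hik : Odd (i + k)
  · rw [coeff_monicOrthPoly_eq_zero_of_odd hd le_rfl hα hi hik, zero_mul]
  · rw [adjMatrix_pow_apply_eq_zero_iff.2, mul_zero]
    rintro p rfl
    have := hconn.even_add_dist_of_walk hodd p (by grind)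
    grind

omit hd in
theorem dist_ne_dist_of_adj {u v w : V} (h : G.Adj v w) (hv : G.dist u v < d) :
    G.dist u w ≠ G.dist u v := by
  intro he
  obtain ⟨p, hp⟩ := hconn.exists_walk_length_eq_dist u v
  have := hconn.even_add_dist_of_walk hodd (p.concat h)
    (by rw [Walk.length_concat, he, hp]; omega)
  rw [Walk.length_concat, he, hp] at this
  grind

variable (hbip : ¬ G.IsBipartite)
include hbip

omit hodd in
theorem card_distinctEigenvalues_sub_one_pos : 0 < d := by
  have := hconn.nonempty
  obtain ⟨r, u, v, hadj, he⟩ := exists_adj_dist_eq_of_not_isBipartite hbip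
  by_contra h0
  have h1 := hconn.dist_le_of_card_distinctEigenvalues hd u v
  have h2 := dist_eq_one_iff_adj.2 hadj
  omega

-- If `α_d` vanished too, odd closed walks would have length at least `2d + 3`; but
-- non-bipartiteness gives one of length `2 dist + 1 ≤ 2d + 1`.
omit hodd in
theorem preintersectionAlpha_ne_zero (hα : ∀ i < d, G.preintersectionAlpha i = 0) :
    G.preintersectionAlpha d ≠ 0 := by
  intro h
  obtain ⟨r, u, v, w, -, hw⟩ := hconn.exists_odd_closed_walk hbip
  have h1 := le_length_of_preintersectionAlpha_eq_zero hd (le_refl (d + 1))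
    (fun i hi => (Nat.le_of_lt_succ hi).lt_or_eq.elim (hα i) fun h' => h' ▸ h) r w
    (by rw [hw]; exact odd_two_mul_add_one _)
  have := hconn.dist_le_of_card_distinctEigenvalues hd r u
  omega

/-- Downward induction on `i`, starting from `q_{d+1}(A) = 0`, with `t = d + 1 - i`. -/
theorem adjEval_monicOrthPoly_apply_eq_zero_of_dist_lt {i : ℕ} (hi : i ≤ d + 1) {u v : V}
    (huv : G.dist u v < i) : G.adjEval (G.monicOrthPoly i) u v = 0 := by
  have hα : ∀ j < d, G.preintersectionAlpha j = 0 := fun j hj =>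
    preintersectionAlpha_eq_zero_of_odd_closed_walk hd le_rfl hodd hj
  have hpos := card_distinctEigenvalues_sub_one_pos hd hconn hbip
  obtain ⟨t, ht⟩ := Nat.exists_eq_add_of_le hi
  induction t using Nat.strong_induction_on generalizing i u v with
  | _ t ih =>
    match t with
    | 0 =>
      obtain rfl : i = d + 1 := by omega
      rw [adjEval_monicOrthPoly_succ hd]; rfl
    | 1 =>
      obtain rfl : i = d := by omega
      by_cases hpar : Odd (i + G.dist u v)
      · exact adjEval_monicOrthPoly_apply_eq_zero_of_odd hd hconn hodd le_rfl hpar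
      -- When `dist u v` has the parity of `d`, the neighbours of `v` lie at distances of the other
      -- parity from `u`, so `(A q_d(A))_{uv} = 0`. The recurrence reduces to `α_d q_d(A)_{uv} = 0`,
      -- and `α_d ≠ 0`.
      obtain ⟨e, rfl⟩ : ∃ e, i = e + 1 := ⟨i - 1, by omega⟩
      have h3 := congrArg (fun p => G.adjEval p u v) (X_mul_monicOrthPoly_succ hd (le_refl (e + 1)))
      simp only [adjEval_X_mul_apply] at h3
      rw [Finset.sum_eq_zero] at h3
      · simp only [adjEval, map_add, map_mul, aeval_C] at h3
        rw [show aeval (G.adjMatrix ℝ) (G.monicOrthPoly (e + 2)) = 0 from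
          adjEval_monicOrthPoly_succ hd, zero_add, Matrix.add_apply, ← Algebra.smul_def,
          ← Algebra.smul_def, Matrix.smul_apply, Matrix.smul_apply,
          show aeval (G.adjMatrix ℝ) (G.monicOrthPoly e) u v = 0 from
            adjEval_monicOrthPoly_apply_eq_zero_of_odd hd hconn hodd (by omega) (by grind),
          smul_zero, add_zero, smul_eq_mul, eq_comm, mul_eq_zero] at h3
        exact h3.resolve_left (preintersectionAlpha_ne_zero hd hconn hbip hα)
      · intro w hw
        rw [mem_neighborFinset] at hw
        apply adjEval_monicOrthPoly_apply_eq_zero_of_odd hd hconn hodd le_rfl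
        have h1 := dist_ne_dist_of_adj hconn hodd hw huv
        have h2 := hw.diff_dist_adj (u := u)
        grind
    | t + 2 =>
      -- Neighbours of `v` are at distance less than `i + 1` from `u`, so every term of the
      -- recurrence except the one in `q_i` vanishes by induction.
      have h3 := congrArg (fun p => G.adjEval p u v)
        (X_mul_monicOrthPoly_succ hd (by omega : i + 1 ≤ d))
      have hN := spectralInner_monicOrthPoly_self_ne_zero hd (by omega : i ≤ d)
      have hN' := spectralInner_monicOrthPoly_self_ne_zero hd (by omega : i + 1 ≤ d)
      simp only [adjEval_X_mul_apply] at h3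
      rw [Finset.sum_eq_zero] at h3
      · simp only [adjEval, map_add, map_mul, aeval_C] at h3
        rw [← Algebra.smul_def, ← Algebra.smul_def, Matrix.add_apply, Matrix.add_apply,
          Matrix.smul_apply, Matrix.smul_apply,
          show aeval (G.adjMatrix ℝ) (G.monicOrthPoly (i + 2)) u v = 0 from
            ih t (by omega) (by omega) (by omega) (by omega),
          show aeval (G.adjMatrix ℝ) (G.monicOrthPoly (i + 1)) u v = 0 from
            ih (t + 1) (by omega) (by omega) (by omega) (by omega),
          smul_zero, zero_add, zero_add, smul_eq_mul, eq_comm, mul_eq_zero] at h3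
        exact h3.resolve_left (div_ne_zero hN' hN)
      · intro w hw
        rw [mem_neighborFinset] at hw
        have h2 := hw.diff_dist_adj (u := u)
        exact ih (t + 1) (by omega) (by omega) (by omega) (by omega)

theorem adjEval_monicOrthPoly_apply_of_dist_ne {i : ℕ} (hi : i ≤ d + 1) {u v : V}
    (huv : G.dist u v ≠ i) : G.adjEval (G.monicOrthPoly i) u v = 0 := by
  rcases lt_or_gt_of_ne huv with h | h
  · exact adjEval_monicOrthPoly_apply_eq_zero_of_dist_lt hd hconn hodd hbip hi h
  · exact adjEval_apply_eq_zero_of_natDegree_lt_dist (by rwa [natDegree_monicOrthPoly])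

/-- On the diagonal of `A q_1(A) = A²`, only the constant term of the recurrence survives, so every
degree equals `⟨q_1, q_1⟩ / ⟨q_0, q_0⟩`. -/
theorem exists_isRegularOfDegree : ∃ k, G.IsRegularOfDegree k := by
  have hpos := card_distinctEigenvalues_sub_one_pos hd hconn hbip
  have hα : G.preintersectionAlpha 0 = 0 :=
    preintersectionAlpha_eq_zero_of_odd_closed_walk hd le_rfl hodd hpos
  have h1 : G.monicOrthPoly 1 = X := by rw [monicOrthPoly_one hd, hα, map_zero, sub_zero]
  have h3 := X_mul_monicOrthPoly_succ hd (by omega : 0 + 1 ≤ d)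
  obtain ⟨r⟩ := hconn.nonempty
  have key : ∀ u, (G.degree u : ℝ) = G.spectralInner (G.monicOrthPoly (0 + 1))
      (G.monicOrthPoly (0 + 1)) / G.spectralInner (G.monicOrthPoly 0) (G.monicOrthPoly 0) := by
    intro u
    have h4 := congrArg (fun p => G.adjEval p u u) h3
    have h5 := adjEval_monicOrthPoly_apply_of_dist_ne hd hconn hodd hbip
      (by omega : 0 + 2 ≤ d + 1) (u := u) (v := u) (by simp)
    have h6 := adjEval_monicOrthPoly_apply_of_dist_ne hd hconn hodd hbip
      (by omega : 0 + 1 ≤ d + 1) (u := u) (v := u) (by simp)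
    simp only [adjEval, map_add, map_mul, aeval_C, ← Algebra.smul_def, Matrix.add_apply,
      Matrix.smul_apply] at h4 h5 h6
    rw [h5, h6, zero_add, zero_add, h1, aeval_X, ← zero_add 1, monicOrthPoly_zero, map_one,
      Matrix.one_apply_eq, smul_zero, zero_add, smul_eq_mul, mul_one,
      adjMatrix_mul_self_apply_self] at h4
    rw [h4, monicOrthPoly_zero, h1]
  exact ⟨G.degree r, fun u => Nat.cast_injective (R := ℝ) ((key u).trans (key r).symm)⟩

theorem exists_adjEval_apply_eq_mul {p : ℝ[X]} (hp : p.degree < ((d + 1 : ℕ) : WithBot ℕ)) :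
    ∃ e : ℕ → ℝ, ∀ u v,
      G.adjEval p u v = e (G.dist u v) * G.adjEval (G.monicOrthPoly (G.dist u v)) u v := by
  let S : Submodule ℝ ℝ[X] :=
    { carrier := {p | ∃ e : ℕ → ℝ, ∀ u v,
        G.adjEval p u v = e (G.dist u v) * G.adjEval (G.monicOrthPoly (G.dist u v)) u v}
      add_mem' := by
        rintro a b ⟨e, he⟩ ⟨f, hf⟩
        refine ⟨e + f, fun u v => ?_⟩
        rw [Pi.add_apply, add_mul, ← he, ← hf, adjEval, map_add]
        rfl
      zero_mem' := ⟨0, by simp [adjEval]⟩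
      smul_mem' := by
        rintro c a ⟨e, he⟩
        refine ⟨c • e, fun u v => ?_⟩
        rw [Pi.smul_apply, smul_eq_mul, mul_assoc, ← he, adjEval, map_smul]
        rfl }
  have h : degreeLT ℝ (d + 1) ≤ S := G.degreeLT_le_of_monicOrthPoly_mem fun j hj => by
    refine ⟨fun i => if i = j then 1 else 0, fun u v => ?_⟩
    beta_reduce
    by_cases he : G.dist u v = j
    · rw [if_pos he, he, one_mul]
    · rw [if_neg he, zero_mul]
      exact adjEval_monicOrthPoly_apply_of_dist_ne hd hconn hodd hbip (by omega) he
  exact h (mem_degreeLT.2 hp)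

/-- Dividing the minimal polynomial by `x - k`, for `k` the valency, gives `E` with `A E(A) = k
E(A)`, so `E(A)` has all entries equal to some `c ≠ 0`. Expanding `E` in the `q_i`, whose supports
at `A` are disjoint, forces each `q_i(A)` to be constant and nonzero at distance `i`. -/
theorem exists_adjEval_monicOrthPoly_apply_eq :
    ∃ s : ℕ → ℝ, ∀ u v, s (G.dist u v) ≠ 0 ∧
      G.adjEval (G.monicOrthPoly (G.dist u v)) u v = s (G.dist u v) := by
  obtain ⟨k, hk⟩ := exists_isRegularOfDegree hd hconn hodd hbip
  have hne := hconn.nonempty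
  have hmem : (k : ℝ) ∈ G.distinctEigenvalues := by
    rw [mem_distinctEigenvalues]
    refine ⟨Function.const V 1, fun h => ?_, ?_⟩
    · obtain ⟨r⟩ := hne
      exact one_ne_zero (congrFun h r)
    · ext v
      rw [adjMatrix_mulVec_const_apply_of_regular hk]
      simp
  obtain ⟨E, hE⟩ := dvd_iff_isRoot.2 (G.eval_eigenvaluePoly hmem)
  have hE0 : E ≠ 0 := fun h => G.eigenvaluePoly_monic.ne_zero (by rw [hE, h, mul_zero])
  have hdeg : E.natDegree = d := by
    have h1 := G.natDegree_eigenvaluePoly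
    rw [hE, natDegree_mul (X_sub_C_ne_zero _) hE0, natDegree_X_sub_C, hd] at h1
    omega
  have hAE : G.adjMatrix ℝ * G.adjEval E = (k : ℝ) • G.adjEval E := by
    have h1 := G.adjEval_eigenvaluePoly
    rw [hE, adjEval, map_mul, map_sub, aeval_X, aeval_C, sub_mul, ← Algebra.smul_def] at h1
    exact sub_eq_zero.1 h1
  obtain ⟨c, hc⟩ := hconn.exists_const_of_adjMatrix_mul_eq_smul hk (G.transpose_adjEval E) hAE
  have hc0 : c ≠ 0 := by
    rintro rfl
    refine hE0 (G.eq_zero_of_adjEval_eq_zero ?_ (by omega))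
    ext u v
    exact hc u v
  obtain ⟨e, he⟩ := exists_adjEval_apply_eq_mul hd hconn hodd hbip (p := E)
    (by rw [degree_eq_natDegree hE0, hdeg]; exact_mod_cast Nat.lt_succ_self d)
  refine ⟨fun i => c / e i, fun u v => ?_⟩
  have h1 : e (G.dist u v) * G.adjEval (G.monicOrthPoly (G.dist u v)) u v = c := by
    rw [← he, hc]
  have h2 : e (G.dist u v) ≠ 0 := fun h => hc0 (by rw [← h1, h, zero_mul])
  exact ⟨div_ne_zero hc0 h2, by rw [eq_div_iff h2, mul_comm, h1]⟩

theorem exists_adjEval_apply_eq_dist (p : ℝ[X]) :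
    ∃ g : ℕ → ℝ, ∀ u v, G.adjEval p u v = g (G.dist u v) := by
  have := hconn.nonempty
  obtain ⟨r, hr, he⟩ := G.exists_degree_lt_adjEval_eq p
  rw [hd] at hr
  obtain ⟨e, he'⟩ := exists_adjEval_apply_eq_mul hd hconn hodd hbip hr
  obtain ⟨s, hs⟩ := exists_adjEval_monicOrthPoly_apply_eq hd hconn hodd hbip
  exact ⟨fun i => e i * s i, fun u v => by rw [← he, he', (hs u v).2]⟩

/-- The `(u, v)` entry of `A q_i(A)` is a nonzero constant times the count, and every polynomial in
`A` depends only on distance. -/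
theorem card_neighbors_at_dist_eq {u v u' v' : V} (h : G.dist u v = G.dist u' v') (i : ℕ) :
    {w : V | G.Adj v w ∧ G.dist u w = i}.ncard = {w : V | G.Adj v' w ∧ G.dist u' w = i}.ncard := by
  obtain ⟨s, hs⟩ := exists_adjEval_monicOrthPoly_apply_eq hd hconn hodd hbip
  obtain ⟨g, hg⟩ := exists_adjEval_apply_eq_dist hd hconn hodd hbip (X * G.monicOrthPoly i)
  have hcard : ∀ u v, {w : V | G.Adj v w ∧ G.dist u w = i}.ncard =
      ((G.neighborFinset v).filter fun w => G.dist u w = i).card := by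
    intro u v
    rw [← Set.ncard_coe_finset]
    congr 1; ext w; simp
  by_cases hi : ∃ a b, G.dist a b = i
  · obtain ⟨a, b, rfl⟩ := hi
    have hab := hconn.dist_le_of_card_distinctEigenvalues hd a b
    have key : ∀ u v, g (G.dist u v) = s (G.dist a b) *
        (((G.neighborFinset v).filter fun w => G.dist u w = G.dist a b).card : ℝ) := by
      intro u v
      rw [← hg, adjEval_X_mul_apply, Finset.card_filter, Nat.cast_sum, Finset.mul_sum]
      refine Finset.sum_congr rfl fun w _ => ?_
      by_cases hw : G.dist u w = G.dist a b
      · rw [if_pos hw, ← hw, (hs u w).2, Nat.cast_one, mul_one]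
      · rw [if_neg hw, Nat.cast_zero, mul_zero]
        exact adjEval_monicOrthPoly_apply_of_dist_ne hd hconn hodd hbip (by omega) hw
    rw [hcard, hcard]
    have h1 := (key u v).symm.trans ((congrArg g h).trans (key u' v'))
    exact_mod_cast mul_left_cancel₀ (hs a b).1 h1
  · push Not at hi
    simp [hi]

theorem isDistanceRegular_of_odd_closed_walk : G.IsDistanceRegular := by
  refine ⟨hconn, fun u v u' v' h => ⟨?_, ?_, ?_⟩⟩
  · rw [interC, interC, ← h]
    rcases Nat.eq_zero_or_pos (G.dist u v) with h0 | hpos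
    · simp [h0]
    · have h1 := card_neighbors_at_dist_eq hd hconn hodd hbip h (G.dist u v - 1)
      have h2 : ∀ n, n + 1 = G.dist u v ↔ n = G.dist u v - 1 := fun n => by omega
      simpa only [h2] using h1
  · rw [interA, interA, ← h]
    exact card_neighbors_at_dist_eq hd hconn hodd hbip h _
  · rw [interB, interB, ← h]
    exact card_neighbors_at_dist_eq hd hconn hodd hbip h _

theorem isGeneralizedOdd_of_odd_closed_walk : G.IsGeneralizedOdd := by
  refine ⟨isDistanceRegular_of_odd_closed_walk hd hconn hodd hbip, ?_⟩
  have := hconn.nonempty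
  obtain ⟨a, b, hab⟩ := G.exists_dist_eq_diam
  have h1 := hconn.dist_le_of_card_distinctEigenvalues hd a b
  obtain ⟨r, u, v, w, -, hw⟩ := hconn.exists_odd_closed_walk hbip
  have h2 : G.dist r u ≤ G.diam := dist_le_diam (connected_iff_ediam_ne_top.1 hconn)
  -- The lower bound uses that the diameter is at most `d`; the upper bound comes from the odd
  -- closed walk of length `2 dist + 1`.
  refine le_antisymm ?_ (le_oddGirth_iff.2 fun v w hw => le_trans (by omega) (hodd v w hw))
  obtain ⟨x, c, hc, hle⟩ := w.exists_odd_isCycle (by rw [hw]; exact odd_two_mul_add_one _)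
  refine (iInf_le_of_le x (iInf_le_of_le c (iInf_le _ hc))).trans (Nat.cast_le.2 ?_)
  omega

end OddGirthTheorem

/-! ### Distance-regular graphs have at most `D + 1` distinct eigenvalues -/

section Converse

variable {V : Type*} [Fintype V] [DecidableEq V] {G : SimpleGraph V} [DecidableRel G.Adj]

theorem IsDistanceRegular.exists_adjMatrix_pow_apply_eq (h : G.IsDistanceRegular) (k : ℕ) :
    ∃ g : ℕ → ℝ, ∀ u v, (G.adjMatrix ℝ ^ k) u v = g (G.dist u v) := by
  induction k with
  | zero =>
    refine ⟨fun i => if i = 0 then 1 else 0, fun u v => ?_⟩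
    simp [Matrix.one_apply, h.1.dist_eq_zero_iff]
  | succ k ih =>
    obtain ⟨g, hg⟩ := ih
    have key : ∀ u v, (G.adjMatrix ℝ ^ (k + 1)) u v =
        (G.interC u v : ℝ) * g (G.dist u v - 1) + (G.interA u v : ℝ) * g (G.dist u v) +
          (G.interB u v : ℝ) * g (G.dist u v + 1) := by
      intro u v
      have hcard : ∀ P : V → Prop, ∀ [DecidablePred P], ({w : V | G.Adj v w ∧ P w}.ncard : ℝ) =
          ∑ w ∈ G.neighborFinset v, if P w then 1 else 0 := by
        intro P _
        rw [← Finset.natCast_card_filter, ← Set.ncard_coe_finset]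
        congr 2; ext w; simp
      rw [pow_succ, mul_adjMatrix_apply, interC, interA, interB, hcard, hcard, hcard,
        Finset.sum_mul, Finset.sum_mul, Finset.sum_mul, ← Finset.sum_add_distrib,
        ← Finset.sum_add_distrib]
      refine Finset.sum_congr rfl fun w hw => ?_
      rw [mem_neighborFinset] at hw
      rw [hg]
      have hw' : G.dist u w = G.dist u v ∨ G.dist u w = G.dist u v + 1 ∨
          G.dist u w + 1 = G.dist u v := by
        have := hw.diff_dist_adj (u := u)
        omega
      rcases hw' with h1 | h1 | h1
      · simp [h1]
      · simp [h1, show ¬ (G.dist u v + 1 + 1 = G.dist u v) by omega]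
      · simp [← h1, show ¬ (G.dist u w = G.dist u w + 1 + 1) by omega]
    classical
    -- The value at `i` is read off at a chosen pair at distance `i`; distance-regularity makes the
    -- choice immaterial.
    refine ⟨fun i => if hi : ∃ u v, G.dist u v = i then
      (G.adjMatrix ℝ ^ (k + 1)) hi.choose hi.choose_spec.choose else 0, fun u v => ?_⟩
    have hi : ∃ u' v', G.dist u' v' = G.dist u v := ⟨u, v, rfl⟩
    have h2 := hi.choose_spec.choose_spec
    obtain ⟨h3, h4, h5⟩ := h.2 _ _ _ _ h2
    simp only [hi, dif_pos]
    rw [key, key, h2, h3, h4, h5]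

/-- Polynomials of degree below the number of distinct eigenvalues embed, by evaluation at `A`, into
the matrices depending only on distance, a space of dimension at most `D + 1`. -/
theorem IsDistanceRegular.card_distinctEigenvalues_le (h : G.IsDistanceRegular) :
    G.distinctEigenvalues.card ≤ G.diam + 1 := by
  have := h.1.nonempty
  have hdist : ∀ u v, G.dist u v < G.diam + 1 := fun u v =>
    Nat.lt_succ_of_le (dist_le_diam (connected_iff_ediam_ne_top.1 h.1))
  let T : (Fin (G.diam + 1) → ℝ) →ₗ[ℝ] Matrix V V ℝ :=
    { toFun := fun f u v => f ⟨G.dist u v, hdist u v⟩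
      map_add' := fun f g => rfl
      map_smul' := fun c f => rfl }
  let F : degreeLT ℝ G.distinctEigenvalues.card →ₗ[ℝ] Matrix V V ℝ :=
    (aeval (G.adjMatrix ℝ)).toLinearMap.domRestrict _
  have hF : Function.Injective F := by
    rw [injective_iff_map_eq_zero]
    rintro ⟨p, hp⟩ h0
    refine Subtype.ext ?_
    by_contra hne
    refine hne (G.eq_zero_of_adjEval_eq_zero h0 ?_)
    rw [mem_degreeLT, degree_eq_natDegree hne] at hp
    exact_mod_cast hp
  have hFT : LinearMap.range F ≤ LinearMap.range T := by
    rintro _ ⟨⟨p, hp⟩, rfl⟩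
    change aeval (G.adjMatrix ℝ) p ∈ _
    rw [aeval_eq_sum_range]
    refine Submodule.sum_mem _ fun k _ => Submodule.smul_mem _ _ ?_
    obtain ⟨g, hg⟩ := h.exists_adjMatrix_pow_apply_eq k
    refine ⟨fun i => g i, ?_⟩
    ext u v
    exact (hg u v).symm
  have h1 := LinearMap.finrank_range_of_inj hF
  rw [(degreeLTEquiv ℝ _).finrank_eq, Module.finrank_fin_fun] at h1
  have h2 := LinearMap.finrank_range_le T
  rw [Module.finrank_fin_fun] at h2
  exact h1 ▸ (Submodule.finrank_mono hFT).trans h2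

end Converse
end SimpleGraph

/-! ### The main theorem -/

open SimpleGraph in
theorem mainTheorem2 {V : Type*} [Fintype V] [DecidableEq V] (G : SimpleGraph V)
    [DecidableRel G.Adj] (hconn : G.Connected) (hbip : ¬ G.IsBipartite)
    (d : ℕ) (hd : G.distinctEigenvalues.card = d + 1) :
    ((∀ i < d, 0 ≤ G.preintersectionAlpha i) →
      -(∑ i ∈ Finset.Icc 1 d, G.distinctEigenvalue i) ≤ G.preintersectionGamma d ∧
      (G.preintersectionGamma d = -(∑ i ∈ Finset.Icc 1 d, G.distinctEigenvalue i) ↔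
        G.IsGeneralizedOdd)) ∧
    (((2 * d - 1 : ℕ) : ℕ∞) ≤ G.oddGirth →
      G.preintersectionGamma d = -(∑ i ∈ Finset.Icc 1 d, G.distinctEigenvalue i) →
      G.IsGeneralizedOdd) := by
  have hpos := card_distinctEigenvalues_sub_one_pos hd hconn hbip
  have hγ := preintersectionGamma_eq hd hpos
  have hmain : (∀ i < d, G.preintersectionAlpha i = 0) → G.IsGeneralizedOdd := fun hα =>
    isGeneralizedOdd_of_odd_closed_walk hd hconn
      (le_length_of_preintersectionAlpha_eq_zero hd (by omega) hα) hbip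
  refine ⟨fun hα => ?_, fun hg he => ?_⟩
  · have hα' : ∀ i ∈ Finset.range d, 0 ≤ G.preintersectionAlpha i := fun i hi =>
      hα i (Finset.mem_range.1 hi)
    refine ⟨by linarith [Finset.sum_nonneg hα'], fun he => ?_, fun h => ?_⟩
    · rw [hγ, add_eq_left, Finset.sum_eq_zero_iff_of_nonneg hα'] at he
      exact hmain fun i hi => he i (Finset.mem_range.2 hi)
    · have h1 := h.1.card_distinctEigenvalues_le
      have hodd := le_oddGirth_iff.1 h.2.ge
      rw [hγ, add_eq_left]
      refine Finset.sum_eq_zero fun i hi => preintersectionAlpha_eq_zero_of_odd_closed_walk hd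
        le_rfl (fun v w hw => le_trans (by omega) (hodd v w hw)) (Finset.mem_range.1 hi)
  · obtain ⟨e, rfl⟩ : ∃ e, d = e + 1 := ⟨d - 1, by omega⟩
    have hodd := le_oddGirth_iff.1 hg
    -- With `d = e + 1` the girth bound reads `2e + 1`, so `α_e` is the only term left in the sum.
    have hα : ∀ i < e, G.preintersectionAlpha i = 0 := fun i hi =>
      preintersectionAlpha_eq_zero_of_odd_closed_walk hd (by omega)
        (fun v w hw => le_trans (by omega) (hodd v w hw)) hi
    rw [hγ, add_eq_left, Finset.sum_range_succ,
      Finset.sum_eq_zero fun i hi => hα i (Finset.mem_range.1 hi), zero_add] at he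
    exact hmain fun i hi => (Nat.le_of_lt_succ hi).lt_or_eq.elim (hα i) fun h => h ▸ he
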